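/- All graphs are finite and simple. For a vertex $v$ of a graph $G$ let $E(v)$ be the set of edges incident with $v$. $G$ is \emph{single conflict $k$-colorable} if for every collection of maps $c_v : E(v) \to \{1,\dots,k\}$ $(v \in V(G))$ there is a map $\varphi : V(G) \to \{1,\dots,k\}$ such that no edge $e = xy$ satisfies both $\varphi(x) = c_x(e)$ and $\varphi(y) = c_y(e)$. $G$ is \emph{adaptably $k$-choosable} if for every assignment of finite lists $L(v) \subset \mathbb{Z}$ with $|L(v)| \ge k$ to the vertices and every edge coloring $f : E(G) \to \mathbb{Z}$ there is a map $c : V(G) \to \mathbb{Z}$ with $c(v) \in L(v)$ for all $v$ such that no edge $xy$ satisfies $c(x) = c(y) = f(xy)$. **Proposition.** (a) A connected graph $G$ with minimum degree at least $2$ is single conflict $2$-colorable if and only if $G$ consists of two or three internally disjoint paths connecting two distinct vertices of $G$ (that is, $G$ is the union of two or three pairwise different paths joining the same two distinct vertices, any two of which share only these two end vertices). (b) A graph is single conflict $2$-colorable if and only if it is adaptably $2$-choosable. -/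

import Mathlib

namespace SimpleGraph

/-- A local `k`-partition of `G`: for every vertex `v` a map `c v` from the set of edges incident
with `v` to a set of `k` colors. -/
abbrev LocalPartition {V : Type*} (G : SimpleGraph V) (k : ℕ) : Type _ :=
  (v : V) → G.incidenceSet v → Fin k

/-- The vertex coloring `φ` avoids the conflict pair `(c x e, c y e)` of every edge `e = xy`. -/
def IsConflictColoring {V : Type*} {G : SimpleGraph V} {k : ℕ}
    (c : G.LocalPartition k) (φ : V → Fin k) : Prop :=
  ∀ (x y : V) (e : Sym2 V) (hx : e ∈ G.incidenceSet x) (hy : e ∈ G.incidenceSet y),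
    e = s(x, y) → ¬ (φ x = c x ⟨e, hx⟩ ∧ φ y = c y ⟨e, hy⟩)

/-- `G` is conflict `c`-colorable for every local `k`-partition `c`. -/
def SingleConflictColorable {V : Type*} (G : SimpleGraph V) (k : ℕ) : Prop :=
  ∀ c : G.LocalPartition k, ∃ φ : V → Fin k, IsConflictColoring c φ

/-- The vertex coloring `c` is adapted to the edge coloring `f`: no edge has the same color as
both of its ends. -/
def IsAdapted {V : Type*} {G : SimpleGraph V} (f : G.edgeSet → ℤ) (c : V → ℤ) : Prop :=
  ∀ (x y : V) (h : s(x, y) ∈ G.edgeSet), ¬ (c x = c y ∧ c y = f ⟨s(x, y), h⟩)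

/-- For all lists of size at least `k` and every edge coloring, there is a coloring from the lists
that is adapted to the edge coloring. -/
def AdaptablyChoosable {V : Type*} (G : SimpleGraph V) (k : ℕ) : Prop :=
  ∀ L : V → Finset ℤ, (∀ v, k ≤ (L v).card) → ∀ f : G.edgeSet → ℤ,
    ∃ c : V → ℤ, (∀ v, c v ∈ L v) ∧ IsAdapted f c

/-- `G` consists of `n` (pairwise different) internally disjoint paths joining two distinct
vertices: it is the union of these paths. -/
def ConsistsOfDisjointPaths {V : Type*} (G : SimpleGraph V) (n : ℕ) : Prop :=
  ∃ u v : V, u ≠ v ∧ ∃ p : Fin n → G.Path u v,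
    (∀ i j, i ≠ j → p i ≠ p j ∧
      ∀ w, w ∈ (p i : G.Walk u v).support → w ∈ (p j : G.Walk u v).support → w = u ∨ w = v) ∧
    (∀ w, ∃ i, w ∈ (p i : G.Walk u v).support) ∧
    (∀ e ∈ G.edgeSet, ∃ i, e ∈ (p i : G.Walk u v).edges)

end SimpleGraph

namespace SimpleGraph

variable {V : Type*}

/-! ### Colorability in terms of functions of ordered pairs -/

/-! Single conflict 2-colorability implies adaptable 2-choosability, since two colors picked from
each list give an instance with one conflict per edge. The converse goes through the structure
theorem in (a), proved from the weaker hypothesis of adaptable choosability.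

Sufficiency in (a): a path, whatever its conflicts, excludes at most one of the four color pairs at
its ends (`Walk.IsPath.exists_forbidden_pair`), so three internally disjoint paths leave a pair that
extends to all of them.

Necessity: by choosing the inner lists and edge colors, a segment can be made to forbid a prescribed
pair `(α, β)` at its ends, provided `α = β` if it is a single edge and `α ≠ β` if it has exactly one
inner vertex (`Seg.exists_forbidding`). Segments with disjoint interiors are independent, so an
uncolorable instance only has to be designed on the branch vertices. This rules out two cycles
sharing one vertex, dumbbells, four internally disjoint paths between two vertices, and subdivisions
of `K₄`. In a finite connected graph of minimum degree at least two, a part that is not everything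
acquires an ear or a lollipop. Starting from a cycle, one enlargement gives a theta graph or an
excluded configuration; a second one always gives an excluded configuration.

For (b), a smallest vertex set needing a coloring may be assumed connected with minimum degree at
least two inside it, and the structure theorem applies. -/

theorem singleConflictColorable_iff {G : SimpleGraph V} {k : ℕ} [NeZero k] :
    G.SingleConflictColorable k ↔ ∀ c : V → V → Fin k, ∃ φ : V → Fin k,
      ∀ x y, G.Adj x y → ¬ (φ x = c x y ∧ φ y = c y x) := by
  classical
  constructor
  · intro h c
    obtain ⟨φ, hφ⟩ := h fun v e => c v (Sym2.Mem.other e.2.2)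
    refine ⟨φ, fun x y hxy => ?_⟩
    have hx : s(x, y) ∈ G.incidenceSet x := ⟨hxy, Sym2.mem_mk_left x y⟩
    have hy : s(x, y) ∈ G.incidenceSet y := ⟨hxy, Sym2.mem_mk_right x y⟩
    have h1 : Sym2.Mem.other hx.2 = y :=
      Sym2.congr_right.1 (Sym2.other_spec hx.2)
    have h2 : Sym2.Mem.other hy.2 = x :=
      Sym2.congr_right.1 ((Sym2.other_spec hy.2).trans Sym2.eq_swap)
    have := hφ x y s(x, y) hx hy rfl
    simpa only [h1, h2] using this
  · intro h c
    obtain ⟨φ, hφ⟩ := h fun x y => if hxy : G.Adj x y then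
      c x ⟨s(x, y), hxy, Sym2.mem_mk_left x y⟩ else 0
    refine ⟨φ, ?_⟩
    rintro x y e hx hy rfl
    have hxy : G.Adj x y := hx.1
    have := hφ x y hxy
    simpa only [hxy, hxy.symm, dif_pos, Sym2.eq_swap (a := y) (b := x)] using this

theorem adaptablyChoosable_iff {G : SimpleGraph V} {k : ℕ} :
    G.AdaptablyChoosable k ↔ ∀ L : V → Finset ℤ, (∀ v, k ≤ (L v).card) → ∀ f : Sym2 V → ℤ,
      ∃ c : V → ℤ, (∀ v, c v ∈ L v) ∧ ∀ x y, G.Adj x y → ¬ (c x = c y ∧ c y = f s(x, y)) := by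
  classical
  constructor
  · intro h L hL f
    obtain ⟨c, hc, hc'⟩ := h L hL fun e => f e
    exact ⟨c, hc, fun x y hxy => hc' x y hxy⟩
  · intro h L hL f
    obtain ⟨c, hc, hc'⟩ := h L hL fun e => if he : e ∈ G.edgeSet then f ⟨e, he⟩ else 0
    refine ⟨c, hc, fun x y hxy => ?_⟩
    have := hc' x y hxy
    simpa only [hxy, dif_pos] using this

theorem SingleConflictColorable.adaptablyChoosable {G : SimpleGraph V}
    (h : G.SingleConflictColorable 2) : G.AdaptablyChoosable 2 := by
  classical
  rw [singleConflictColorable_iff] at h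
  rw [adaptablyChoosable_iff]
  intro L hL f
  have hex : ∀ v, ∃ a b, a ∈ L v ∧ b ∈ L v ∧ a ≠ b := fun v => by
    obtain ⟨a, ha, b, hb, hab⟩ := Finset.one_lt_card.1 (hL v)
    exact ⟨a, b, ha, hb, hab⟩
  choose a b ha hb hab using hex
  -- Colors 0 and 1 stand for `a x` and `b x`. At most one of these is the color of the edge; if
  -- neither is, the value 1 only adds a harmless constraint.
  obtain ⟨φ, hφ⟩ := h fun x y => if a x = f s(x, y) then 0 else 1
  refine ⟨fun v => if φ v = 0 then a v else b v, fun v => ?_, fun x y hxy => ?_⟩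
  · dsimp only
    split_ifs
    exacts [ha v, hb v]
  · have key : ∀ v e, (if φ v = 0 then a v else b v) = f e →
        φ v = if a v = f e then 0 else 1 := by
      intro v e hv
      by_cases h0 : φ v = 0
      · rw [if_pos h0] at hv
        rw [if_pos hv, h0]
      · rw [if_neg h0] at hv
        have h1 : a v ≠ f e := fun h => hab v (h.trans hv.symm)
        rw [if_neg h1]
        omega
    rintro ⟨h1, h2⟩
    refine hφ x y hxy ⟨key x _ (h1.trans h2), ?_⟩
    have := key y _ h2
    rwa [Sym2.eq_swap] at this

/-! ### Two-colorings of internally disjoint paths -/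

/-- Induction along the path: if the tail forbids only `(a₁, b₁)`, then prepending the edge `uw`
forbids only `(c u w, b₁)`. For `a ≠ c u w` the first edge is already satisfied, so `w` can avoid
`a₁`; for `a = c u w` the color of `w` is determined by that edge, but then `b ≠ b₁` and the tail
accepts any color at `w`. -/
theorem Walk.IsPath.exists_forbidden_pair {G : SimpleGraph V} (c : V → V → Fin 2) {u v : V}
    (p : G.Walk u v) (hp : p.IsPath) (huv : u ≠ v) :
    ∃ q : Fin 2 × Fin 2, ∀ a b, (a, b) ≠ q → ∃ φ : V → Fin 2, φ u = a ∧ φ v = b ∧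
      ∀ x y, s(x, y) ∈ p.edges → ¬ (φ x = c x y ∧ φ y = c y x) := by
  classical
  induction p with
  | nil => exact absurd rfl huv
  | @cons u w v h p ih =>
    rw [Walk.cons_isPath_iff] at hp
    obtain ⟨hp, hu⟩ := hp
    have hedge : ∀ (φ : V → Fin 2), ¬ (φ u = c u w ∧ φ w = c w u) →
        ∀ x y, s(x, y) = s(u, w) → ¬ (φ x = c x y ∧ φ y = c y x) := by
      intro φ hφ x y hxy
      rcases Sym2.eq_iff.1 hxy with ⟨rfl, rfl⟩ | ⟨rfl, rfl⟩
      · exact hφ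
      · exact fun h => hφ h.symm
    by_cases hwv : w = v
    · subst hwv
      obtain rfl : p = Walk.nil := Walk.eq_nil_iff_nil.2 (Walk.isPath_iff_nil.1 hp)
      refine ⟨(c u w, c w u), fun a b hab => ?_⟩
      refine ⟨fun x => if x = u then a else b, by simp, by simp [huv.symm], fun x y hxy => ?_⟩
      rw [Walk.edges_cons, Walk.edges_nil, List.mem_singleton] at hxy
      refine hedge (fun x => if x = u then a else b) ?_ x y hxy
      rintro ⟨h1, h2⟩
      simp only [if_true, if_neg huv.symm] at h1 h2
      exact hab (Prod.ext h1 h2)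
    · obtain ⟨⟨a₁, b₁⟩, hq⟩ := ih hp hwv
      refine ⟨(c u w, b₁), fun a b hab => ?_⟩
      obtain ⟨d, hd1, hd2⟩ : ∃ d : Fin 2, (d, b) ≠ (a₁, b₁) ∧ ¬ (a = c u w ∧ d = c w u) := by
        by_cases ha : a = c u w
        · have hb : b ≠ b₁ := fun hb => hab (by rw [ha, hb])
          refine ⟨1 - c w u, fun h => hb (Prod.ext_iff.1 h).2, fun h => ?_⟩
          omega
        · refine ⟨1 - a₁, fun h => ?_, fun h => ha h.1⟩
          have := (Prod.ext_iff.1 h).1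
          simp only at this
          omega
      obtain ⟨φ, hw, hv, hφ⟩ := hq d b hd1
      refine ⟨Function.update φ u a, by simp, by simpa [huv.symm] using hv, fun x y hxy => ?_⟩
      rw [Walk.edges_cons, List.mem_cons] at hxy
      rcases hxy with hxy | hxy
      · refine hedge _ ?_ x y hxy
        simpa [h.ne.symm, hw] using hd2
      · have hx : x ≠ u := fun h => hu (h ▸ p.fst_mem_support_of_mem_edges hxy)
        have hy : y ≠ u := fun h => hu (h ▸ p.snd_mem_support_of_mem_edges hxy)
        simpa [hx, hy] using hφ x y hxy

/-- There are four pairs of end colors and at most three are forbidden. For a remaining pair the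
colorings of the paths agree at `u` and `v`, the only vertices they share, and so glue together. -/
theorem ConsistsOfDisjointPaths.singleConflictColorable {G : SimpleGraph V} {n : ℕ} (hn : n ≤ 3)
    (h : G.ConsistsOfDisjointPaths n) : G.SingleConflictColorable 2 := by
  classical
  rw [singleConflictColorable_iff]
  intro c
  obtain ⟨u, v, huv, p, hp, hV, hE⟩ := h
  choose q hq using fun i =>
    Walk.IsPath.exists_forbidden_pair c (p i : G.Walk u v) (p i).2 huv
  obtain ⟨⟨a, b⟩, hab⟩ : ∃ r : Fin 2 × Fin 2, r ∉ Finset.univ.image q := by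
    by_contra! hall
    have h1 : (Finset.univ : Finset (Fin 2 × Fin 2)).card ≤ (Finset.univ.image q).card :=
      Finset.card_le_card fun r _ => hall r
    have h2 := (Finset.card_image_le (s := Finset.univ) (f := q))
    simp at h1 h2
    omega
  have hab' : ∀ i, (a, b) ≠ q i := fun i h =>
    hab (Finset.mem_image.2 ⟨i, Finset.mem_univ i, h.symm⟩)
  choose φ hu hv hφ using fun i => hq i a b (hab' i)
  choose I hI using hV
  refine ⟨fun w => φ (I w) w, ?_⟩
  have key : ∀ i w, w ∈ (p i : G.Walk u v).support → φ (I w) w = φ i w := by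
    intro i w hw
    by_cases hi : I w = i
    · rw [hi]
    · rcases (hp _ _ hi).2 w (hI w) hw with rfl | rfl
      · rw [hu, hu]
      · rw [hv, hv]
  intro x y hxy
  obtain ⟨i, hi⟩ := hE s(x, y) hxy
  dsimp only
  rw [key i x (Walk.fst_mem_support_of_mem_edges _ hi),
    key i y (Walk.snd_mem_support_of_mem_edges _ hi)]
  exact hφ i x y hi

/-! ### Segments: paths and cycles given by their list of interior vertices -/

/-- The edges of the walk from `u` to `v` with list of interior vertices `l`. -/
def pathEdges (u : V) : List V → V → List (Sym2 V)
  | [], v => [s(u, v)]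
  | x :: l, v => s(u, x) :: pathEdges x l v

theorem mem_pathEdges_append {u v x : V} {l l' : List V} {e : Sym2 V} :
    e ∈ pathEdges u (l ++ x :: l') v ↔ e ∈ pathEdges u l x ∨ e ∈ pathEdges x l' v := by
  induction l generalizing u with
  | nil => simp [pathEdges]
  | cons y l ih => simp [pathEdges, ih, or_assoc]

theorem mem_pathEdges_reverse {u v : V} {l : List V} {e : Sym2 V} :
    e ∈ pathEdges v l.reverse u ↔ e ∈ pathEdges u l v := by
  induction l generalizing u with
  | nil => simp [pathEdges, Sym2.eq_swap]
  | cons y l ih =>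
    rw [List.reverse_cons, mem_pathEdges_append, ih]
    simp [pathEdges, Sym2.eq_swap (a := u), or_comm]

theorem mem_of_mem_pathEdges {u v w : V} {l : List V} {e : Sym2 V} (he : e ∈ pathEdges u l v)
    (hw : w ∈ e) : w = u ∨ w ∈ l ∨ w = v := by
  induction l generalizing u with
  | nil =>
    simp only [pathEdges, List.mem_singleton] at he
    subst he
    simpa using hw
  | cons x l ih =>
    rcases List.mem_cons.1 he with rfl | he
    · rcases Sym2.mem_iff.1 hw with rfl | rfl <;> simp
    · rcases ih he with rfl | h | h <;> simp [*]

theorem exists_mem_of_mem_pathEdges {u v : V} {l : List V} {e : Sym2 V}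
    (he : e ∈ pathEdges u l v) : (l = [] ∧ e = s(u, v)) ∨ ∃ x ∈ l, x ∈ e := by
  induction l generalizing u with
  | nil => simpa [pathEdges] using he
  | cons x l ih =>
    rcases List.mem_cons.1 he with rfl | he
    · exact Or.inr ⟨x, by simp, by simp⟩
    · rcases ih he with ⟨-, rfl⟩ | ⟨y, hy, hy'⟩
      · exact Or.inr ⟨x, by simp, by simp⟩
      · exact Or.inr ⟨y, by simp [hy], hy'⟩

/-- `l` lists the interior vertices of a path of `G` from `u` to `v` or, if `u = v`, of a cycle
through `u`. -/
structure Seg (G : SimpleGraph V) (u : V) (l : List V) (v : V) : Prop where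
  edges : ∀ e ∈ pathEdges u l v, e ∈ G.edgeSet
  nodup : l.Nodup
  left : u ∉ l
  right : v ∉ l
  closed : u = v → 2 ≤ l.length

theorem Seg.reverse {G : SimpleGraph V} {u v : V} {l : List V} (h : G.Seg u l v) :
    G.Seg v l.reverse u where
  edges e he := h.edges e (mem_pathEdges_reverse.1 he)
  nodup := List.nodup_reverse.2 h.nodup
  left := by simpa using h.right
  right := by simpa using h.left
  closed e := by simpa using h.closed e.symm

theorem Seg.append_left {G : SimpleGraph V} {u v x : V} {l l' : List V}
    (h : G.Seg u (l ++ x :: l') v) : G.Seg u l x where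
  edges e he := h.edges e (mem_pathEdges_append.2 (Or.inl he))
  nodup := by have := h.nodup; grind
  left := by have := h.left; grind
  right := by have := h.nodup; grind
  closed e := by have := h.left; grind

theorem Seg.append_right {G : SimpleGraph V} {u v x : V} {l l' : List V}
    (h : G.Seg u (l ++ x :: l') v) : G.Seg x l' v where
  edges e he := h.edges e (mem_pathEdges_append.2 (Or.inr he))
  nodup := by have := h.nodup; grind
  left := by have := h.nodup; grind
  right := by have := h.right; grind
  closed e := by have := h.right; grind

theorem Seg.append {G : SimpleGraph V} {u v x : V} {l l' : List V}
    (h : G.Seg u l x) (h' : G.Seg x l' v) (hu : u ≠ x) (hv : v ≠ x) (hul : u ∉ l') (hvl : v ∉ l)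
    (hll : ∀ w ∈ l, w ∉ l') (hc : u = v → l = [] → l' ≠ []) : G.Seg u (l ++ x :: l') v where
  edges e he := (mem_pathEdges_append.1 he).elim (h.edges e) (h'.edges e)
  nodup := by have := h.nodup; have := h'.nodup; have := h.right; have := h'.left; grind
  left := by have := h.left; grind
  right := by have := h'.right; grind
  closed e := by
    have := hc e
    rcases l with _ | ⟨a, l⟩ <;> rcases l' with _ | ⟨b, l'⟩ <;> simp_all; omega

theorem Seg.exists_path {G : SimpleGraph V} {u v : V} {l : List V} (h : G.Seg u l v)
    (huv : u ≠ v) : ∃ p : G.Path u v, (p : G.Walk u v).support = u :: (l ++ [v]) ∧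
      (p : G.Walk u v).edges = pathEdges u l v := by
  have key : ∀ (l : List V) (u : V), (∀ e ∈ pathEdges u l v, e ∈ G.edgeSet) →
      ∃ p : G.Walk u v, p.support = u :: (l ++ [v]) ∧ p.edges = pathEdges u l v := by
    intro l
    induction l with
    | nil =>
      intro u h
      have h : G.Adj u v := h s(u, v) (by simp [pathEdges])
      exact ⟨h.toWalk, by simp, by simp [pathEdges]⟩
    | cons x l ih =>
      intro u h
      have hux : G.Adj u x := h s(u, x) (by simp [pathEdges])
      obtain ⟨p, hp, hp'⟩ := ih x fun e he => h e (by simp [pathEdges, he])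
      exact ⟨Walk.cons hux p, by simp [hp], by simp [pathEdges, hp']⟩
  obtain ⟨p, hp, hp'⟩ := key l u h.edges
  refine ⟨⟨p, ?_⟩, hp, hp'⟩
  rw [Walk.isPath_def, hp]
  have := h.nodup; have := h.left; have := h.right
  grind

/-! ### Uncolorable instances -/

/-- A segment together with a color at each of its ends. -/
structure ColoredSeg (V : Type*) where
  u : V
  l : List V
  v : V
  α : ℤ
  β : ℤ

/-- Forcing along the segment: if `u` has color `α`, the edge `ux` has color `α` and `x` has list
`{α, γ}`, then `x` must take `γ`, and so on until the last edge forbids `β` at `v`. Successive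
forced colors differ, which explains the condition for one inner vertex. Only inner lists and
segment edges are changed, so that several segments can be treated in turn. -/
theorem Seg.exists_forbidding {G : SimpleGraph V} {u v : V} {l : List V} {α β : ℤ}
    (h : G.Seg u l v) (h0 : l = [] → α = β) (h1 : l.length = 1 → α ≠ β)
    (L : V → Finset ℤ) (hL : ∀ w, 2 ≤ (L w).card) (f : Sym2 V → ℤ) :
    ∃ (L' : V → Finset ℤ) (f' : Sym2 V → ℤ), (∀ w, 2 ≤ (L' w).card) ∧ (∀ w, w ∉ l → L' w = L w) ∧
      (∀ e, e ∉ pathEdges u l v → f' e = f e) ∧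
      ∀ c : V → ℤ, (∀ w ∈ l, c w ∈ L' w) →
        (∀ x y, s(x, y) ∈ pathEdges u l v → ¬ (c x = c y ∧ c y = f' s(x, y))) →
        ¬ (c u = α ∧ c v = β) := by
  classical
  induction l generalizing u α with
  | nil =>
    refine ⟨L, Function.update f s(u, v) α, hL, fun _ _ => rfl, fun e he => ?_, ?_⟩
    · simp only [pathEdges, List.mem_singleton] at he
      simp [he]
    · rintro c - hc ⟨hu, hv⟩
      exact hc u v (by simp [pathEdges]) ⟨by rw [hu, hv, h0 rfl], by simp [hv, h0 rfl]⟩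
  | cons x l ih =>
    -- The color forced at `x`: it has to be `β` if `x` is the last inner vertex; otherwise a color
    -- different from both `α` and `β` suits a tail of any length.
    obtain ⟨γ, hγα, hγ0, hγ1⟩ :
        ∃ γ : ℤ, γ ≠ α ∧ (l = [] → γ = β) ∧ (l.length = 1 → γ ≠ β) := by
      rcases l with _ | ⟨y, l⟩
      · exact ⟨β, (h1 rfl).symm, fun _ => rfl, by simp⟩
      · refine ⟨max α β + 1, ?_, by simp, fun _ => ?_⟩
        · have := le_max_left α β
          omega
        · have := le_max_right α β
          omega
    obtain ⟨L', f', hL', hLl, hf', hc⟩ := ih (h.append_right (l := [])) hγ0 hγ1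
    have hxl : x ∉ l := by have := h.nodup; grind
    -- The first edge does not recur, so recoloring it leaves the tail intact. For `u = v` this
    -- needs the segment to be a genuine cycle, hence `closed`.
    have hne : s(u, x) ∉ pathEdges x l v := by
      intro he
      have hu := h.left
      rcases mem_of_mem_pathEdges he (Sym2.mem_mk_left u x) with e | e | e
      · simp [e] at hu
      · simp [e] at hu
      · have hcl := h.closed e
        rcases exists_mem_of_mem_pathEdges he with ⟨rfl, -⟩ | ⟨y, hy, hy'⟩
        · simp at hcl
        · rcases Sym2.mem_iff.1 hy' with rfl | rfl <;> simp_all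
    refine ⟨Function.update L' x {α, γ}, Function.update f' s(u, x) α, fun w => ?_, fun w hw => ?_,
      fun e he => ?_, fun c hcL hcf hcuv => ?_⟩
    · by_cases hw : w = x
      · subst hw
        simp [Finset.card_pair hγα.symm]
      · simpa [hw] using hL' w
    · rw [List.mem_cons, not_or] at hw
      simpa [hw.1] using hLl w hw.2
    · simp only [pathEdges, List.mem_cons, not_or] at he
      simpa [he.1] using hf' e he.2
    have hfe : ∀ e ∈ pathEdges x l v, Function.update f' s(u, x) α e = f' e := fun e he =>
      Function.update_of_ne (by rintro rfl; exact hne he) _ _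
    have hcx : c x = α ∨ c x = γ := by simpa using hcL x (by simp)
    have hcx' : c x = γ := by
      refine hcx.resolve_left fun hx => hcf u x (by simp [pathEdges]) ⟨hcuv.1.trans hx.symm, ?_⟩
      rw [hx, Function.update_self]
    refine hc c (fun w hw => ?_) (fun y z hyz => ?_) ⟨hcx', hcuv.2⟩
    · have := hcL w (by simp [hw])
      rwa [Function.update_of_ne (by rintro rfl; exact hxl hw)] at this
    · have := hcf y z (by simp [pathEdges, hyz])
      rwa [hfe _ hyz] at this

theorem exists_instance_of_coloredSegs {G : SimpleGraph V} (L₀ : V → Finset ℤ)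
    (hL₀ : ∀ w, 2 ≤ (L₀ w).card) (Ps : List (ColoredSeg V))
    (hseg : ∀ P ∈ Ps, G.Seg P.u P.l P.v ∧ (P.l = [] → P.α = P.β) ∧ (P.l.length = 1 → P.α ≠ P.β))
    (hends : ∀ P ∈ Ps, ∀ Q ∈ Ps, P.u ∉ Q.l ∧ P.v ∉ Q.l)
    (hdisj : Ps.Pairwise fun P Q => (∀ w ∈ P.l, w ∉ Q.l) ∧
      (P.l = [] → Q.l = [] → s(P.u, P.v) ≠ s(Q.u, Q.v))) :
    ∃ (L : V → Finset ℤ) (f : Sym2 V → ℤ), (∀ w, 2 ≤ (L w).card) ∧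
      (∀ w, (∀ P ∈ Ps, w ∉ P.l) → L w = L₀ w) ∧
      ∀ c : V → ℤ, (∀ w, (∃ P ∈ Ps, w ∈ P.l) → c w ∈ L w) →
        (∀ P ∈ Ps, ∀ x y, s(x, y) ∈ pathEdges P.u P.l P.v → ¬ (c x = c y ∧ c y = f s(x, y))) →
        ∀ P ∈ Ps, ¬ (c P.u = P.α ∧ c P.v = P.β) := by
  induction Ps with
  | nil => exact ⟨L₀, fun _ => 0, hL₀, fun _ _ => rfl, by simp⟩
  | cons P Ps ih =>
    rw [List.pairwise_cons] at hdisj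
    obtain ⟨L, f, hL, hLL, hc⟩ := ih (fun Q hQ => hseg Q (by simp [hQ]))
      (fun Q hQ R hR => hends Q (by simp [hQ]) R (by simp [hR])) hdisj.2
    obtain ⟨hP, hP0, hP1⟩ := hseg P (by simp)
    obtain ⟨L', f', hL', hLL', hff', hc'⟩ := hP.exists_forbidding hP0 hP1 L hL f
    have hedge : ∀ Q ∈ Ps, ∀ e ∈ pathEdges Q.u Q.l Q.v, e ∉ pathEdges P.u P.l P.v := by
      intro Q hQ e he he'
      have hPQ := hdisj.1 Q hQ
      have h1 := hends P (by simp) Q (by simp [hQ])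
      have h2 := hends Q (by simp [hQ]) P (by simp)
      rcases exists_mem_of_mem_pathEdges he with ⟨h, rfl⟩ | ⟨x, hx, hx'⟩
      · rcases exists_mem_of_mem_pathEdges he' with ⟨h', e⟩ | ⟨x, hx, hx'⟩
        · exact hPQ.2 h' h e.symm
        · rcases Sym2.mem_iff.1 hx' with rfl | rfl
          exacts [h2.1 hx, h2.2 hx]
      · rcases mem_of_mem_pathEdges he' hx' with rfl | h | rfl
        exacts [h1.1 hx, hPQ.1 x h hx, h1.2 hx]
    refine ⟨L', f', hL', fun w hw => ?_, fun c hcL hcf Q hQ => ?_⟩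
    · rw [hLL' w (hw P (by simp)), hLL w fun Q hQ => hw Q (by simp [hQ])]
    rcases List.mem_cons.1 hQ with rfl | hQ
    · exact hc' c (fun w hw => hcL w ⟨Q, by simp, hw⟩) (hcf Q (by simp))
    · refine hc c (fun w ⟨R, hR, hw⟩ => ?_) (fun R hR x y hxy => ?_) Q hQ
      · have := hcL w ⟨R, by simp [hR], hw⟩
        rwa [hLL' w fun h => (hdisj.1 R hR).1 w h hw] at this
      · have := hcf R (by simp [hR]) x y hxy
        rwa [hff' _ (hedge R hR _ hxy)] at this

/-- Reduces non-choosability to a finite puzzle on the segment ends: lists `L₀` there such that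
every choice realizes some forbidden pair. -/
theorem not_adaptablyChoosable_of_coloredSegs {G : SimpleGraph V} (L₀ : V → Finset ℤ)
    (hL₀ : ∀ w, 2 ≤ (L₀ w).card) (Ps : List (ColoredSeg V))
    (hseg : ∀ P ∈ Ps, G.Seg P.u P.l P.v ∧ (P.l = [] → P.α = P.β) ∧ (P.l.length = 1 → P.α ≠ P.β))
    (hends : ∀ P ∈ Ps, ∀ Q ∈ Ps, P.u ∉ Q.l ∧ P.v ∉ Q.l)
    (hdisj : Ps.Pairwise fun P Q => (∀ w ∈ P.l, w ∉ Q.l) ∧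
      (P.l = [] → Q.l = [] → s(P.u, P.v) ≠ s(Q.u, Q.v)))
    (hunsat : ∀ c : V → ℤ, (∀ P ∈ Ps, c P.u ∈ L₀ P.u ∧ c P.v ∈ L₀ P.v) →
      ∃ P ∈ Ps, c P.u = P.α ∧ c P.v = P.β) : ¬ G.AdaptablyChoosable 2 := by
  rw [adaptablyChoosable_iff]
  intro h
  obtain ⟨L, f, hL, hLL, hc⟩ := exists_instance_of_coloredSegs L₀ hL₀ Ps hseg hends hdisj
  obtain ⟨c, hcL, hcf⟩ := h L hL f
  obtain ⟨P, hP, hP'⟩ := hunsat c fun P hP => by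
    rw [← hLL P.u fun Q hQ => (hends P hP Q hQ).1, ← hLL P.v fun Q hQ => (hends P hP Q hQ).2]
    exact ⟨hcL _, hcL _⟩
  exact hc c (fun w _ => hcL w) (fun Q hQ x y hxy => hcf x y ((hseg Q hQ).1.edges _ hxy)) P hP hP'

/-! ### Configurations that are not adaptably 2-choosable -/

/-- A cycle has at least two inner vertices, so it can forbid any one color at its base. The two
cycles exclude both colors in the list of `v`. -/
theorem not_adaptablyChoosable_of_two_cycles {G : SimpleGraph V} {v : V} {l l' : List V}
    (h : G.Seg v l v) (h' : G.Seg v l' v) (hd : ∀ w ∈ l, w ∉ l') :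
    ¬ G.AdaptablyChoosable 2 := by
  have := h.closed rfl
  have := h'.closed rfl
  refine not_adaptablyChoosable_of_coloredSegs (fun _ => {0, 1}) (by simp)
    [⟨v, l, v, 0, 0⟩, ⟨v, l', v, 1, 1⟩] ?_ ?_ ?_ ?_
  · simp [h, h']; omega
  · simp [h.left, h'.left]
  · simp; grind
  · intro c hc
    simp at hc ⊢
    grind

/-- The cycles force color 1 at `v` and `γ` at `w`, and the connecting path forbids `(1, γ)`; `γ` is
adjusted to the length of that path. -/
theorem not_adaptablyChoosable_of_dumbbell {G : SimpleGraph V} {v w : V} {l l' m : List V}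
    (hvw : v ≠ w) (h : G.Seg v l v) (h' : G.Seg w l' w) (hm : G.Seg v m w)
    (hd : ∀ x ∈ l, x ∉ l') (hlm : ∀ x ∈ l, x ∉ m) (hlm' : ∀ x ∈ l', x ∉ m)
    (hv : v ∉ l') (hw : w ∉ l) : ¬ G.AdaptablyChoosable 2 := by
  classical
  have := h.closed rfl
  have := h'.closed rfl
  obtain ⟨γ, hγ, h0, h1⟩ : ∃ γ : ℤ, γ ≠ 3 ∧ (m = [] → γ = 1) ∧ (m.length = 1 → γ ≠ 1) := by
    rcases m with _ | ⟨a, m⟩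
    · exact ⟨1, by simp⟩
    · exact ⟨2, by simp⟩
  refine not_adaptablyChoosable_of_coloredSegs (fun x => if x = v then {0, 1} else {3, γ})
    (fun x => ?_) [⟨v, l, v, 0, 0⟩, ⟨v, m, w, 1, γ⟩, ⟨w, l', w, 3, 3⟩] ?_ ?_ ?_ ?_
  · split_ifs <;> simp [Finset.card_pair hγ.symm]
  · simp [h, h', hm]; grind
  · simp [h.left, h'.left, hv, hw, hm.left, hm.right]
  · simp; grind
  · intro c hc
    simp [hvw.symm] at hc ⊢
    grind

/-- Each path forbids one of the four pairs from `{0, 1} × {3, γ}`. Only `l₁` may be a single edge;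
it gets `(0, γ)`, with `γ = 0` in that case, while the other three pairs always have distinct
entries. -/
theorem not_adaptablyChoosable_of_four_paths {G : SimpleGraph V} {a b : V}
    {l₁ l₂ l₃ l₄ : List V} (hab : a ≠ b)
    (h₁ : G.Seg a l₁ b) (h₂ : G.Seg a l₂ b) (h₃ : G.Seg a l₃ b) (h₄ : G.Seg a l₄ b)
    (n₂ : l₂ ≠ []) (n₃ : l₃ ≠ []) (n₄ : l₄ ≠ [])
    (d₁₂ : ∀ x ∈ l₁, x ∉ l₂) (d₁₃ : ∀ x ∈ l₁, x ∉ l₃) (d₁₄ : ∀ x ∈ l₁, x ∉ l₄)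
    (d₂₃ : ∀ x ∈ l₂, x ∉ l₃) (d₂₄ : ∀ x ∈ l₂, x ∉ l₄) (d₃₄ : ∀ x ∈ l₃, x ∉ l₄) :
    ¬ G.AdaptablyChoosable 2 := by
  classical
  obtain ⟨γ, hγ, hγ1, h0, h1⟩ :
      ∃ γ : ℤ, γ ≠ 3 ∧ γ ≠ 1 ∧ (l₁ = [] → γ = 0) ∧ (l₁.length = 1 → γ ≠ 0) := by
    rcases l₁ with _ | ⟨a, m⟩
    · exact ⟨0, by simp⟩
    · exact ⟨2, by simp⟩
  refine not_adaptablyChoosable_of_coloredSegs (fun x => if x = a then {0, 1} else {3, γ})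
    (fun x => ?_) [⟨a, l₁, b, 0, γ⟩, ⟨a, l₂, b, 0, 3⟩, ⟨a, l₃, b, 1, γ⟩, ⟨a, l₄, b, 1, 3⟩]
    ?_ ?_ ?_ ?_
  · split_ifs <;> simp [Finset.card_pair hγ.symm]
  · simp [h₁, h₂, h₃, h₄, n₂, n₃, n₄]; grind
  · simp [h₁.left, h₁.right, h₂.left, h₂.right, h₃.left, h₃.right, h₄.left, h₄.right]
  · simp; grind
  · intro c hc
    simp [hab.symm] at hc ⊢
    grind

set_option synthInstance.maxSize 1000 in
-- Labels for the branch vertices of a 4-cycle whose sides have `p, q, r, s` inner vertices, meeting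
-- the side conditions for forbidden pairs. The excluded case is contradictory: three equalities and
-- one inequality around a cycle.
theorem exists_cycle_labels (p q r s : ℕ) (h : p + q + r + s ≠ 1) :
    ∃ x y z w : Fin 3, ((p = 0 → x = y) ∧ (p = 1 → x ≠ y)) ∧ ((q = 0 → y = z) ∧ (q = 1 → y ≠ z)) ∧
      ((r = 0 → z = w) ∧ (r = 1 → z ≠ w)) ∧ ((s = 0 → w = x) ∧ (s = 1 → w ≠ x)) := by
  -- Only 0, 1 and "at least 2" need distinguishing, so the lengths are truncated at 2; by symmetry
  -- of the labels the first is 0. This leaves a finite check.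
  have key : ∀ p q r s : Fin 3, (p : ℕ) + q + r + s ≠ 1 → ∃ y z w : Fin 3,
      ((p = 0 → 0 = y) ∧ (p = 1 → 0 ≠ y)) ∧ ((q = 0 → y = z) ∧ (q = 1 → y ≠ z)) ∧
      ((r = 0 → z = w) ∧ (r = 1 → z ≠ w)) ∧ ((s = 0 → w = 0) ∧ (s = 1 → w ≠ 0)) := by
    decide
  have hlt : ∀ n : ℕ, min n 2 < 3 := fun n => by omega
  have h0 : ∀ n : ℕ, n = 0 → (⟨min n 2, hlt n⟩ : Fin 3) = 0 := fun n hn => by simp [hn]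
  have h1 : ∀ n : ℕ, n = 1 → (⟨min n 2, hlt n⟩ : Fin 3) = 1 := fun n hn => by simp [hn]
  obtain ⟨y, z, w, ⟨a, b⟩, ⟨c, d⟩, ⟨e, f⟩, g, i⟩ := key ⟨min p 2, hlt p⟩ ⟨min q 2, hlt q⟩
    ⟨min r 2, hlt r⟩ ⟨min s 2, hlt s⟩ (by simp only; omega)
  exact ⟨0, y, z, w, ⟨fun h => a (h0 p h), fun h => b (h1 p h)⟩,
    ⟨fun h => c (h0 q h), fun h => d (h1 q h)⟩, ⟨fun h => e (h0 r h), fun h => f (h1 r h)⟩,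
    ⟨fun h => g (h0 s h), fun h => i (h1 s h)⟩⟩

/-- `G` contains a subdivision of `K₄` with branch vertices `a`, `b`, `c`, `d`. -/
structure SubdividedK4 (G : SimpleGraph V) (a b c d : V) (ab ac ad bc bd cd : List V) : Prop where
  ne : [a, b, c, d].Nodup
  sab : G.Seg a ab b
  sac : G.Seg a ac c
  sad : G.Seg a ad d
  sbc : G.Seg b bc c
  sbd : G.Seg b bd d
  scd : G.Seg c cd d
  branch : ∀ x ∈ [a, b, c, d], ∀ l ∈ [ab, ac, ad, bc, bd, cd], x ∉ l
  disj : [ab, ac, ad, bc, bd, cd].Pairwise fun l l' => ∀ x ∈ l, x ∉ l'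

theorem SubdividedK4.swap {G : SimpleGraph V} {a b c d : V} {ab ac ad bc bd cd : List V}
    (h : G.SubdividedK4 a b c d ab ac ad bc bd cd) :
    G.SubdividedK4 a c b d ac ab ad bc.reverse cd bd where
  ne := by have := h.ne; grind
  sab := h.sac
  sac := h.sab
  sad := h.sad
  sbc := h.sbc.reverse
  sbd := h.scd
  scd := h.sbd
  branch := by have := h.branch; simp at this ⊢; grind
  disj := by have := h.disj; simp at this ⊢; grind

theorem SubdividedK4.rotate {G : SimpleGraph V} {a b c d : V} {ab ac ad bc bd cd : List V}
    (h : G.SubdividedK4 a b c d ab ac ad bc bd cd) :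
    G.SubdividedK4 a d b c ad ab ac bd.reverse cd.reverse bc where
  ne := by have := h.ne; grind
  sab := h.sad
  sac := h.sab
  sad := h.sac
  sbc := h.sbd.reverse
  sbd := h.scd.reverse
  scd := h.sbc
  branch := by have := h.branch; simp at this ⊢; grind
  disj := by have := h.disj; simp at this ⊢; grind

/-- Every branch vertex gets a low color and a high color. The segments `ab` and `cd` forbid both
ends being high, so one of `a, b` and one of `c, d` are low; these two are joined by a side of the
4-cycle `acbd`, which forbids both ends being low. -/
theorem SubdividedK4.not_adaptablyChoosable_of_length {G : SimpleGraph V} {a b c d : V}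
    {ab ac ad bc bd cd : List V} (h : G.SubdividedK4 a b c d ab ac ad bc bd cd)
    (hl : ac.length + bc.length + bd.length + ad.length ≠ 1) : ¬ G.AdaptablyChoosable 2 := by
  classical
  obtain ⟨xa, xc, xb, xd, hac, hbc, hbd, had⟩ := exists_cycle_labels _ _ _ _ hl
  have hy : ∀ l : List V, ∃ y : ℤ, 10 ≤ y ∧ (l = [] → 10 = y) ∧ (l.length = 1 → 10 ≠ y) := by
    rintro (_ | ⟨_, l⟩)
    · exact ⟨10, by simp⟩
    · exact ⟨11, by simp⟩
  obtain ⟨yb, hyb, hab⟩ := hy ab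
  obtain ⟨yd, hyd, hcd⟩ := hy cd
  obtain ⟨f, hf, hf'⟩ : ∃ f : Fin 3 → ℤ, Function.Injective f ∧ ∀ i, f i < 10 :=
    ⟨fun i => i, fun i j hij => by simpa [Fin.ext_iff] using hij, fun i => by simp only; omega⟩
  have ne := h.ne
  have branch := h.branch
  have disj := h.disj
  simp at ne branch disj
  refine not_adaptablyChoosable_of_coloredSegs
    (fun x => if x = a then {f xa, 10} else if x = b then {f xb, yb} else
      if x = c then {f xc, 10} else {f xd, yd}) (fun x => ?_)
    [⟨a, ab, b, 10, yb⟩, ⟨c, cd, d, 10, yd⟩, ⟨a, ac, c, f xa, f xc⟩, ⟨b, bc, c, f xb, f xc⟩,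
      ⟨b, bd, d, f xb, f xd⟩, ⟨a, ad, d, f xa, f xd⟩] ?_ ?_ ?_ ?_
  · have := hf' xa; have := hf' xb; have := hf' xc; have := hf' xd
    split_ifs <;> rw [Finset.card_pair (by omega)]
  · simp [h.sab, h.sac, h.sad, h.sbc, h.sbd, h.scd, hf.eq_iff]
    simp only [List.length_eq_zero_iff] at *
    grind
  · simp; grind
  · simp; grind
  · intro col hc
    simp at hc ⊢
    grind

/-- Otherwise each of the three 4-cycles of `K₄` has exactly one inner subdivision vertex. Every
segment lies on two of these cycles, so the three counts have an even sum, which cannot be 3. -/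
theorem SubdividedK4.not_adaptablyChoosable {G : SimpleGraph V} {a b c d : V}
    {ab ac ad bc bd cd : List V} (h : G.SubdividedK4 a b c d ab ac ad bc bd cd) :
    ¬ G.AdaptablyChoosable 2 := by
  by_contra hG
  have h1 : ac.length + bc.length + bd.length + ad.length = 1 :=
    of_not_not fun hl => h.not_adaptablyChoosable_of_length hl hG
  have h2 : ab.length + bc.length + cd.length + ad.length = 1 :=
    of_not_not fun hl => h.swap.not_adaptablyChoosable_of_length (by simpa using hl) hG
  have h3 : ab.length + bd.length + cd.length + ac.length = 1 :=
    of_not_not fun hl => h.rotate.not_adaptablyChoosable_of_length (by simpa using hl) hG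
  omega

/-! ### Ears and lollipops -/

theorem Seg.cons {G : SimpleGraph V} {u v x : V} {l : List V} (h : G.Seg x l v) (hux : G.Adj u x)
    (hul : u ∉ l) (hxv : x ≠ v) (huv : u = v → l ≠ []) : G.Seg u (x :: l) v where
  edges e he := by
    rcases List.mem_cons.1 he with rfl | he
    exacts [hux, h.edges e he]
  nodup := by have := h.nodup; have := h.left; grind
  left := by have := hux.ne; grind
  right := by have := h.right; grind
  closed e := by
    have := List.length_pos_iff.2 (huv e)
    simp only [List.length_cons]
    omega

/-- The path outside `X` is prolonged at `x` without turning back. By finiteness it ends by reaching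
`X`, giving an ear (possibly closed), or by meeting itself, giving a lollipop. -/
theorem Seg.exists_ear_or_lollipop [Finite V] {G : SimpleGraph V}
    (hdeg : ∀ v a, ∃ b, b ≠ a ∧ G.Adj v b) {X : Set V} {x a : V} {l : List V}
    (h : G.Seg x l a) (hx : x ∉ X) (hl : ∀ y ∈ l, y ∉ X) (ha : a ∈ X) :
    (∃ a ∈ X, ∃ b ∈ X, ∃ l, G.Seg a l b ∧ (∀ x ∈ l, x ∉ X) ∧ l ≠ []) ∨
    ∃ a ∈ X, ∃ w, ∃ l m, w ∉ X ∧ G.Seg a m w ∧ G.Seg w l w ∧ (∀ x ∈ l, x ∉ X) ∧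
      (∀ x ∈ m, x ∉ X) ∧ ∀ x ∈ l, x ∉ m := by
  classical
  have := Fintype.ofFinite V
  induction hn : Fintype.card V - l.length generalizing x l with
  | zero =>
    have h1 : (x :: l).length ≤ Fintype.card V :=
      (List.nodup_cons.2 ⟨h.left, h.nodup⟩).length_le_card
    simp only [List.length_cons] at h1
    omega
  | succ n ih =>
    -- `l.headD a` is the vertex next to `x` on the path; avoiding it makes any closed ear or loop a
    -- genuine cycle.
    obtain ⟨y, hy, hxy⟩ := hdeg x (l.headD a)
    have hxa : x ≠ a := by rintro rfl; exact hx ha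
    by_cases hyX : y ∈ X
    · refine Or.inl ⟨y, hyX, a, ha, x :: l, h.cons hxy.symm (fun h => hl y h hyX) hxa ?_, ?_, ?_⟩
      · rintro rfl rfl
        simp at hy
      · simpa [hx] using hl
      · simp
    by_cases hyl : y ∈ l
    · obtain ⟨l₁, l₂, rfl⟩ := List.append_of_mem hyl
      have hl₁ : l₁ ≠ [] := by rintro rfl; simp at hy
      have hnd := h.nodup
      have hleft := h.left
      have hright := h.right
      refine Or.inr ⟨a, ha, y, x :: l₁, l₂.reverse, hyX, h.append_right.reverse,
        h.append_left.cons hxy.symm ?_ hxy.ne fun _ => hl₁, ?_, ?_, ?_⟩ <;> grind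
    · exact ih (h.cons hxy.symm hyl hxa (by rintro rfl; exact absurd ha hyX)) hyX
        (by simpa [hx] using hl) (by simp only [List.length_cons]; omega)

/-- If `X` misses a vertex, connectivity gives an edge leaving `X`, from which a path is grown.
Otherwise an edge outside `E` is itself an ear with empty interior. -/
theorem Connected.covers_or_exists_ear_or_lollipop [Finite V] {G : SimpleGraph V}
    (hconn : G.Connected) (hdeg : ∀ v a, ∃ b, b ≠ a ∧ G.Adj v b) {X : Set V} (hX : X.Nonempty)
    (E : Set (Sym2 V)) :
    ((∀ v, v ∈ X) ∧ ∀ e ∈ G.edgeSet, e ∈ E) ∨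
    (∃ a ∈ X, ∃ b ∈ X, ∃ l, G.Seg a l b ∧ (∀ x ∈ l, x ∉ X) ∧ (l = [] → s(a, b) ∉ E)) ∨
    ∃ a ∈ X, ∃ w, ∃ l m, w ∉ X ∧ G.Seg a m w ∧ G.Seg w l w ∧ (∀ x ∈ l, x ∉ X) ∧
      (∀ x ∈ m, x ∉ X) ∧ ∀ x ∈ l, x ∉ m := by
  have hedge : ∀ {x y}, G.Adj x y → G.Seg x [] y := fun {x y} hxy =>
    ⟨by simpa [pathEdges] using hxy, by simp, by simp, by simp, fun h => absurd h hxy.ne⟩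
  by_cases hout : ∃ a ∈ X, ∃ x, x ∉ X ∧ G.Adj a x
  · obtain ⟨a, ha, x, hx, hax⟩ := hout
    rcases (hedge hax.symm).exists_ear_or_lollipop hdeg hx (by simp) ha with
      ⟨a, ha, b, hb, l, h, hl, hne⟩ | h
    · exact Or.inr (Or.inl ⟨a, ha, b, hb, l, h, hl, fun h => absurd h hne⟩)
    · exact Or.inr (Or.inr h)
  push Not at hout
  have hall : ∀ v, v ∈ X := by
    obtain ⟨r, hr⟩ := hX
    intro v
    obtain ⟨p⟩ := hconn.preconnected r v
    induction p with
    | nil => exact hr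
    | cons h p ih => exact ih (by_contra fun hx => hout _ hr _ hx h)
  by_cases hE : ∀ e ∈ G.edgeSet, e ∈ E
  · exact Or.inl ⟨hall, hE⟩
  · push Not at hE
    obtain ⟨e, he, heE⟩ := hE
    induction e with
    | _ x y => exact Or.inr (Or.inl ⟨x, hall x, y, hall y, [], hedge he, by simp, fun _ => heE⟩)

theorem exists_cycle [Finite V] {G : SimpleGraph V} (hconn : G.Connected)
    (hdeg : ∀ v a, ∃ b, b ≠ a ∧ G.Adj v b) : ∃ w l, G.Seg w l w := by
  obtain ⟨r⟩ := hconn.nonempty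
  rcases hconn.covers_or_exists_ear_or_lollipop hdeg (Set.singleton_nonempty r) ∅ with
    ⟨-, h⟩ | ⟨a, rfl, b, rfl, l, h, -⟩ | ⟨a, -, w, l, m, -, -, h, -⟩
  · obtain ⟨b, -, hb⟩ := hdeg r r
    exact absurd (h s(r, b) hb) (by simp)
  · exact ⟨_, l, h⟩
  · exact ⟨_, l, h⟩

theorem Seg.rotate {G : SimpleGraph V} {w a : V} {l : List V} (h : G.Seg w l w)
    (ha : a = w ∨ a ∈ l) : ∃ l', G.Seg a l' a ∧ (∀ x, (x = a ∨ x ∈ l') ↔ (x = w ∨ x ∈ l)) ∧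
      ∀ e, e ∈ pathEdges a l' a ↔ e ∈ pathEdges w l w := by
  rcases ha with rfl | ha
  · exact ⟨l, h, fun _ => Iff.rfl, fun _ => Iff.rfl⟩
  · obtain ⟨l₁, l₂, rfl⟩ := List.append_of_mem ha
    have hnd := h.nodup
    have hleft := h.left
    have hlen := h.closed rfl
    refine ⟨l₂ ++ w :: l₁, h.append_right.append h.append_left ?_ ?_ ?_ ?_ ?_ ?_, ?_, ?_⟩
    · grind
    · grind
    · grind
    · grind
    · grind
    · rintro - rfl rfl
      simp at hlen
    · grind
    · intro e
      rw [mem_pathEdges_append, mem_pathEdges_append, or_comm]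

theorem consistsOfDisjointPaths_of_seg {G : SimpleGraph V} {n : ℕ} {a b : V} (hab : a ≠ b)
    (l : Fin n → List V) (hl : ∀ i, G.Seg a (l i) b)
    (hd : ∀ i j, i ≠ j → (∀ x ∈ l i, x ∉ l j) ∧ (l i = [] → l j ≠ []))
    (hV : ∀ x, x = a ∨ x = b ∨ ∃ i, x ∈ l i) (hE : ∀ e ∈ G.edgeSet, ∃ i, e ∈ pathEdges a (l i) b)
    (hn : 0 < n) : G.ConsistsOfDisjointPaths n := by
  choose p hp hpe using fun i => (hl i).exists_path hab
  refine ⟨a, b, hab, p, fun i j hij => ⟨fun h => ?_, fun w hi hj => ?_⟩, fun w => ?_, fun e he => ?_⟩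
  · have h1 : a :: (l i ++ [b]) = a :: (l j ++ [b]) := by rw [← hp, ← hp, h]
    have h2 : l i = l j := by simpa using h1
    have := hd i j hij
    rw [h2] at this
    rcases hj : l j with _ | ⟨x, m⟩
    · exact this.2 hj hj
    · exact this.1 x (by simp [hj]) (by simp [hj])
  · have := (hd i j hij).1 w
    rw [hp] at hi hj
    grind
  · rcases hV w with rfl | rfl | ⟨i, hi⟩
    · exact ⟨⟨0, hn⟩, by simp⟩
    · exact ⟨⟨0, hn⟩, by simp⟩
    · exact ⟨i, by simp [hp, hi]⟩
  · obtain ⟨i, hi⟩ := hE e he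
    exact ⟨i, by rwa [hpe]⟩

/-! ### Theta graphs -/

/-- `l₁`, `l₂`, `l₃` list the interior vertices of three internally disjoint paths of `G` from
`a` to `b`. -/
structure Theta (G : SimpleGraph V) (a b : V) (l₁ l₂ l₃ : List V) : Prop where
  ne : a ≠ b
  s₁ : G.Seg a l₁ b
  s₂ : G.Seg a l₂ b
  s₃ : G.Seg a l₃ b
  d₁₂ : ∀ x ∈ l₁, x ∉ l₂
  d₁₃ : ∀ x ∈ l₁, x ∉ l₃
  d₂₃ : ∀ x ∈ l₂, x ∉ l₃
  n₁₂ : l₁ = [] → l₂ ≠ []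
  n₁₃ : l₁ = [] → l₃ ≠ []
  n₂₃ : l₂ = [] → l₃ ≠ []

theorem Theta.swap {G : SimpleGraph V} {a b : V} {l₁ l₂ l₃ : List V} (h : G.Theta a b l₁ l₂ l₃) :
    G.Theta a b l₂ l₁ l₃ where
  ne := h.ne
  s₁ := h.s₂
  s₂ := h.s₁
  s₃ := h.s₃
  d₁₂ x hx hx' := h.d₁₂ x hx' hx
  d₁₃ := h.d₂₃
  d₂₃ := h.d₁₃
  n₁₂ e e' := h.n₁₂ e' e
  n₁₃ := h.n₂₃
  n₂₃ := h.n₁₃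

theorem Theta.rotate {G : SimpleGraph V} {a b : V} {l₁ l₂ l₃ : List V} (h : G.Theta a b l₁ l₂ l₃) :
    G.Theta a b l₂ l₃ l₁ where
  ne := h.ne
  s₁ := h.s₂
  s₂ := h.s₃
  s₃ := h.s₁
  d₁₂ := h.d₂₃
  d₁₃ x hx hx' := h.d₁₂ x hx' hx
  d₂₃ x hx hx' := h.d₁₃ x hx' hx
  n₁₂ := h.n₂₃
  n₁₃ e e' := h.n₁₂ e' e
  n₂₃ e e' := h.n₁₃ e' e

theorem Theta.reverse {G : SimpleGraph V} {a b : V} {l₁ l₂ l₃ : List V}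
    (h : G.Theta a b l₁ l₂ l₃) : G.Theta b a l₁.reverse l₂.reverse l₃.reverse where
  ne := h.ne.symm
  s₁ := h.s₁.reverse
  s₂ := h.s₂.reverse
  s₃ := h.s₃.reverse
  d₁₂ := by simpa using h.d₁₂
  d₁₃ := by simpa using h.d₁₃
  d₂₃ := by simpa using h.d₂₃
  n₁₂ := by simpa using h.n₁₂
  n₁₃ := by simpa using h.n₁₃
  n₂₃ := by simpa using h.n₂₃

theorem Theta.cycle {G : SimpleGraph V} {a b : V} {l₁ l₂ l₃ : List V}
    (h : G.Theta a b l₁ l₂ l₃) : G.Seg a (l₂ ++ b :: l₃.reverse) a :=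
  h.s₂.append h.s₃.reverse h.ne h.ne (by simpa using h.s₃.left) h.s₂.left (by simpa using h.d₂₃)
    fun _ e => by simpa using h.n₂₃ e

/-- The vertices of a theta graph. -/
def thetaVerts (a b : V) (l₁ l₂ l₃ : List V) : Set V :=
  {x | x = a ∨ x = b ∨ x ∈ l₁ ∨ x ∈ l₂ ∨ x ∈ l₃}

theorem Theta.exists_cycle_through {G : SimpleGraph V} {a b c : V} {l₁ l₂ l₃ : List V}
    (h : G.Theta a b l₁ l₂ l₃) (hc : c ∈ thetaVerts a b l₁ l₂ l₃) :
    ∃ l, G.Seg c l c ∧ ∀ x ∈ l, x ∈ thetaVerts a b l₁ l₂ l₃ := by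
  simp only [thetaVerts, Set.mem_ofPred_eq] at hc ⊢
  by_cases hc1 : c ∈ l₁
  · obtain ⟨l, hl, hl', -⟩ := h.rotate.rotate.cycle.rotate (a := c) (by simp [hc1])
    refine ⟨l, hl, fun x hx => ?_⟩
    have := (hl' x).1 (Or.inr hx)
    grind
  · obtain ⟨l, hl, hl', -⟩ := h.cycle.rotate (a := c) (by simp; tauto)
    refine ⟨l, hl, fun x hx => ?_⟩
    have := (hl' x).1 (Or.inr hx)
    grind

/-- A theta graph together with an ear from `c` to `d` with list of interior vertices `l`. -/
structure ThetaEar (G : SimpleGraph V) (a b : V) (l₁ l₂ l₃ : List V) (c : V) (l : List V) (d : V) :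
    Prop where
  theta : G.Theta a b l₁ l₂ l₃
  seg : G.Seg c l d
  off : ∀ x ∈ l, x ≠ a ∧ x ≠ b ∧ x ∉ l₁ ∧ x ∉ l₂ ∧ x ∉ l₃
  new : l = [] → s(c, d) ∉ pathEdges a l₁ b ∧ s(c, d) ∉ pathEdges a l₂ b ∧
    s(c, d) ∉ pathEdges a l₃ b

theorem ThetaEar.swap {G : SimpleGraph V} {a b c d : V} {l₁ l₂ l₃ l : List V}
    (h : G.ThetaEar a b l₁ l₂ l₃ c l d) : G.ThetaEar a b l₂ l₁ l₃ c l d where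
  theta := h.theta.swap
  seg := h.seg
  off x hx := by have := h.off x hx; tauto
  new e := by have := h.new e; tauto

theorem ThetaEar.rotate {G : SimpleGraph V} {a b c d : V} {l₁ l₂ l₃ l : List V}
    (h : G.ThetaEar a b l₁ l₂ l₃ c l d) : G.ThetaEar a b l₂ l₃ l₁ c l d where
  theta := h.theta.rotate
  seg := h.seg
  off x hx := by have := h.off x hx; tauto
  new e := by have := h.new e; tauto

theorem ThetaEar.reverse {G : SimpleGraph V} {a b c d : V} {l₁ l₂ l₃ l : List V}
    (h : G.ThetaEar a b l₁ l₂ l₃ c l d) :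
    G.ThetaEar b a l₁.reverse l₂.reverse l₃.reverse c l d where
  theta := h.theta.reverse
  seg := h.seg
  off x hx := by have := h.off x hx; simp only [List.mem_reverse]; tauto
  new e := by simpa only [mem_pathEdges_reverse] using h.new e

theorem ThetaEar.reverse_ear {G : SimpleGraph V} {a b c d : V} {l₁ l₂ l₃ l : List V}
    (h : G.ThetaEar a b l₁ l₂ l₃ c l d) : G.ThetaEar a b l₁ l₂ l₃ d l.reverse c where
  theta := h.theta
  seg := h.seg.reverse
  off x hx := h.off x (List.mem_reverse.1 hx)
  new e := by simpa only [Sym2.eq_swap (a := d)] using h.new (List.reverse_eq_nil_iff.1 e)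

/-- The ear is a fourth path. At most one of the four is a single edge, and the cases put that one
first. -/
theorem ThetaEar.not_adaptablyChoosable_of_ends {G : SimpleGraph V} {a b : V}
    {l₁ l₂ l₃ l : List V} (h : G.ThetaEar a b l₁ l₂ l₃ a l b) : ¬ G.AdaptablyChoosable 2 := by
  have hT := h.theta
  have hoff := h.off
  by_cases hl : l = []
  · have hnil : ∀ m : List V, s(a, b) ∉ pathEdges a m b → m ≠ [] := by
      rintro m hm rfl
      simp [pathEdges] at hm
    obtain ⟨h₁, h₂, h₃⟩ := h.new hl
    exact not_adaptablyChoosable_of_four_paths hT.ne h.seg hT.s₁ hT.s₂ hT.s₃ (hnil _ h₁)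
      (hnil _ h₂) (hnil _ h₃) (by grind) (by grind) (by grind) hT.d₁₂ hT.d₁₃ hT.d₂₃
  · have hd₁₂ := hT.d₁₂
    have hd₁₃ := hT.d₁₃
    have hd₂₃ := hT.d₂₃
    by_cases h₁ : l₁ = []
    · exact not_adaptablyChoosable_of_four_paths hT.ne hT.s₁ hT.s₂ hT.s₃ h.seg (hT.n₁₂ h₁)
        (hT.n₁₃ h₁) hl (by grind) (by grind) (by grind) hT.d₂₃ (by grind) (by grind)
    by_cases h₂ : l₂ = []
    · exact not_adaptablyChoosable_of_four_paths hT.ne hT.s₂ hT.s₁ hT.s₃ h.seg h₁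
        (hT.n₂₃ h₂) hl (by grind) (by grind) (by grind) hT.d₁₃ (by grind) (by grind)
    · exact not_adaptablyChoosable_of_four_paths hT.ne hT.s₃ hT.s₁ hT.s₂ h.seg h₁
        h₂ hl (by grind) (by grind) (by grind) hT.d₁₂ (by grind) (by grind)

/-- The ear and the part of `l₁` from `a` to `d` form a cycle meeting the cycle through `l₂` and
`l₃` only in `a`. -/
theorem ThetaEar.not_adaptablyChoosable_of_end_of_interior {G : SimpleGraph V} {a b d : V}
    {l₁ l₂ l₃ l : List V} (h : G.ThetaEar a b l₁ l₂ l₃ a l d) (hd : d ∈ l₁) :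
    ¬ G.AdaptablyChoosable 2 := by
  have hT := h.theta
  have hoff := h.off
  obtain ⟨m, m', rfl⟩ := List.append_of_mem hd
  have hnd := hT.s₁.nodup
  have hl := hT.s₁.left
  have hr := hT.s₁.right
  have hd₁₂ := hT.d₁₂
  have hd₁₃ := hT.d₁₃
  refine not_adaptablyChoosable_of_two_cycles (hT.s₁.append_left.append h.seg.reverse ?_ ?_ ?_ ?_ ?_ ?_)
    hT.cycle ?_
  · grind
  · grind
  · grind
  · grind
  · grind
  · rintro - rfl e
    exact (h.new (List.reverse_eq_nil_iff.1 e)).1 (by simp [pathEdges])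
  · grind

/-- The ear and `m₂` form a cycle, joined by the path `m₁` from `a` to the cycle through `l₂` and
`l₃`: a dumbbell. -/
theorem ThetaEar.not_adaptablyChoosable_of_ordered {G : SimpleGraph V} {a b c d : V}
    {m₁ m₂ m₃ l₂ l₃ l : List V} (h : G.ThetaEar a b (m₁ ++ c :: (m₂ ++ d :: m₃)) l₂ l₃ c l d) :
    ¬ G.AdaptablyChoosable 2 := by
  have hT := h.theta
  have hoff := h.off
  have hnd := hT.s₁.nodup
  have hl := hT.s₁.left
  have hr := hT.s₁.right
  have hd₁₂ := hT.d₁₂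
  have hd₁₃ := hT.d₁₃
  refine not_adaptablyChoosable_of_dumbbell ?_ hT.cycle
    (hT.s₁.append_right.append_left.append h.seg.reverse ?_ ?_ ?_ ?_ ?_ ?_)
    hT.s₁.append_left ?_ ?_ ?_ ?_ ?_
  · grind
  · grind
  · grind
  · grind
  · grind
  · grind
  · rintro - rfl e
    refine (h.new (List.reverse_eq_nil_iff.1 e)).1 ?_
    rw [mem_pathEdges_append, List.nil_append]
    simp [pathEdges]
  all_goals grind

theorem ThetaEar.not_adaptablyChoosable_of_same_path {G : SimpleGraph V} {a b c d : V}
    {l₁ l₂ l₃ l : List V} (h : G.ThetaEar a b l₁ l₂ l₃ c l d) (hcd : c ≠ d) (hc : c ∈ l₁)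
    (hd : d ∈ l₁) : ¬ G.AdaptablyChoosable 2 := by
  obtain ⟨m, m', rfl⟩ := List.append_of_mem hc
  rcases List.mem_append.1 hd with hd | hd
  · obtain ⟨n, n', rfl⟩ := List.append_of_mem hd
    rw [List.append_assoc, List.cons_append] at h
    exact h.reverse_ear.not_adaptablyChoosable_of_ordered
  · obtain ⟨n, n', rfl⟩ := List.append_of_mem ((List.mem_cons.1 hd).resolve_left hcd.symm)
    exact h.not_adaptablyChoosable_of_ordered

/-- An ear between interiors of different paths creates a subdivided `K₄` with branch vertices `a,
b, c, d`. -/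
theorem ThetaEar.not_adaptablyChoosable_of_two_paths {G : SimpleGraph V} {a b c d : V}
    {l₁ l₂ l₃ l : List V} (h : G.ThetaEar a b l₁ l₂ l₃ c l d) (hc : c ∈ l₁)
    (hd : d ∈ l₂) : ¬ G.AdaptablyChoosable 2 := by
  have hT := h.theta
  have hoff := h.off
  have hd₁₂ := hT.d₁₂
  have hd₁₃ := hT.d₁₃
  have hd₂₃ := hT.d₂₃
  have hne := hT.ne
  obtain ⟨m, m', rfl⟩ := List.append_of_mem hc
  obtain ⟨n, n', rfl⟩ := List.append_of_mem hd
  have hnd₁ := hT.s₁.nodup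
  have hl₁ := hT.s₁.left
  have hr₁ := hT.s₁.right
  have hnd₂ := hT.s₂.nodup
  have hl₂ := hT.s₂.left
  have hr₂ := hT.s₂.right
  have hl₃ := hT.s₃.left
  have hr₃ := hT.s₃.right
  have hl := h.seg.left
  have hr := h.seg.right
  have hK : G.SubdividedK4 a b c d l₃ m n m'.reverse n'.reverse l :=
    { ne := by grind
      sab := hT.s₃
      sac := hT.s₁.append_left
      sad := hT.s₂.append_left
      sbc := hT.s₁.append_right.reverse
      sbd := hT.s₂.append_right.reverse
      scd := h.seg
      branch := by simp; grind
      disj := by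
        simp
        refine ⟨⟨?_, ?_, ?_, ?_, ?_⟩, ⟨?_, ?_, ?_, ?_⟩, ⟨?_, ?_, ?_⟩, ⟨?_, ?_⟩, ?_⟩ <;>
          (intro x
           have h₁₂ := hd₁₂ x
           have h₁₃ := hd₁₃ x
           have h₂₃ := hd₂₃ x
           grind) }
  exact hK.not_adaptablyChoosable

theorem ThetaEar.not_adaptablyChoosable {G : SimpleGraph V} {a b c d : V}
    {l₁ l₂ l₃ l : List V} (h : G.ThetaEar a b l₁ l₂ l₃ c l d) (hcd : c ≠ d)
    (hc : c ∈ thetaVerts a b l₁ l₂ l₃) (hd : d ∈ thetaVerts a b l₁ l₂ l₃) :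
    ¬ G.AdaptablyChoosable 2 := by
  have hend : ∀ {a b c l₁ l₂ l₃ l}, G.ThetaEar a b l₁ l₂ l₃ a l c → (c ∈ l₁ ∨ c ∈ l₂ ∨ c ∈ l₃) →
      ¬ G.AdaptablyChoosable 2 := by
    rintro a b c l₁ l₂ l₃ l h (hc | hc | hc)
    exacts [h.not_adaptablyChoosable_of_end_of_interior hc,
      h.rotate.not_adaptablyChoosable_of_end_of_interior hc,
      h.rotate.rotate.not_adaptablyChoosable_of_end_of_interior hc]
  have hint : ∀ {l₁ l₂ l₃}, G.ThetaEar a b l₁ l₂ l₃ c l d → c ∈ l₁ →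
      (d ∈ l₁ ∨ d ∈ l₂ ∨ d ∈ l₃) → ¬ G.AdaptablyChoosable 2 := by
    rintro l₁ l₂ l₃ h hc (hd | hd | hd)
    exacts [h.not_adaptablyChoosable_of_same_path hcd hc hd,
      h.not_adaptablyChoosable_of_two_paths hc hd,
      h.rotate.rotate.swap.not_adaptablyChoosable_of_two_paths hc hd]
  rcases hc with rfl | rfl | hc
  · rcases hd with rfl | rfl | hd
    exacts [absurd rfl hcd, h.not_adaptablyChoosable_of_ends, hend h hd]
  · rcases hd with rfl | rfl | hd
    exacts [h.reverse_ear.not_adaptablyChoosable_of_ends, absurd rfl hcd,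
      hend h.reverse (by simpa using hd)]
  · rcases hd with rfl | rfl | hd
    · exact hend h.reverse_ear hc
    · exact hend h.reverse_ear.reverse (by simpa using hc)
    · rcases hc with hc | hc | hc
      exacts [hint h hc hd, hint h.rotate hc (by tauto), hint h.rotate.rotate hc (by tauto)]

/-! ### Connected graphs of minimum degree at least two -/

/-- A theta graph cannot be enlarged: an ear with distinct ends falls under `ThetaEar`, a closed ear
gives two cycles sharing a vertex, and a lollipop gives a dumbbell. -/
theorem Connected.consistsOfDisjointPaths_of_theta [Finite V] {G : SimpleGraph V}
    (hconn : G.Connected) (hdeg : ∀ v a, ∃ b, b ≠ a ∧ G.Adj v b) (hG : G.AdaptablyChoosable 2)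
    {a b : V} {l₁ l₂ l₃ : List V} (h : G.Theta a b l₁ l₂ l₃) : G.ConsistsOfDisjointPaths 3 := by
  rcases hconn.covers_or_exists_ear_or_lollipop hdeg (X := thetaVerts a b l₁ l₂ l₃)
    ⟨a, Or.inl rfl⟩ {e | e ∈ pathEdges a l₁ b ∨ e ∈ pathEdges a l₂ b ∨ e ∈ pathEdges a l₃ b} with
    ⟨hV, hE⟩ | ⟨c, hc, d, hd, l, hl, hoff, hnew⟩ | ⟨c, hc, w, l, m, hw, hm, hl, hlX, hmX, hlm⟩
  · refine consistsOfDisjointPaths_of_seg h.ne ![l₁, l₂, l₃] ?_ ?_ (fun x => ?_) (fun e he => ?_)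
      (by simp)
    · simp [Fin.forall_fin_succ, h.s₁, h.s₂, h.s₃]
    · have h1 := h.d₁₂; have h2 := h.d₁₃; have h3 := h.d₂₃
      have h4 := h.n₁₂; have h5 := h.n₁₃; have h6 := h.n₂₃
      simp [Fin.forall_fin_succ]
      grind
    · simpa [Fin.exists_fin_succ, thetaVerts] using hV x
    · simpa [Fin.exists_fin_succ] using hE e he
  · by_cases hcd : c = d
    · subst hcd
      obtain ⟨l', hl', hl'X⟩ := h.exists_cycle_through hc
      exact absurd hG (not_adaptablyChoosable_of_two_cycles hl hl'
        fun x hx hx' => hoff x hx (hl'X x hx'))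
    · refine absurd hG (ThetaEar.not_adaptablyChoosable ⟨h, hl, fun x hx => ?_, fun e => ?_⟩
        hcd hc hd)
      · simpa [thetaVerts] using hoff x hx
      · simpa using hnew e
  · obtain ⟨l', hl', hl'X⟩ := h.exists_cycle_through hc
    refine absurd hG (not_adaptablyChoosable_of_dumbbell ?_ hl' hl hm ?_ ?_ hlm ?_ ?_)
    · rintro rfl
      exact hw hc
    · exact fun x hx hx' => hlX x hx' (hl'X x hx)
    · exact fun x hx hx' => hmX x hx' (hl'X x hx)
    · exact fun hx' => hlX c hx' hc
    · exact fun hx => hw (hl'X w hx)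

theorem Connected.consistsOfDisjointPaths [Finite V] {G : SimpleGraph V}
    (hconn : G.Connected) (hdeg : ∀ v a, ∃ b, b ≠ a ∧ G.Adj v b) (hG : G.AdaptablyChoosable 2) :
    G.ConsistsOfDisjointPaths 2 ∨ G.ConsistsOfDisjointPaths 3 := by
  obtain ⟨w, l, h⟩ := exists_cycle hconn hdeg
  rcases hconn.covers_or_exists_ear_or_lollipop hdeg (X := {x | x = w ∨ x ∈ l})
    ⟨w, Or.inl rfl⟩ {e | e ∈ pathEdges w l w} with
    ⟨hV, hE⟩ | ⟨a, ha, b, hb, l', hl', hoff, hnew⟩ | ⟨a, ha, z, l', m, hz, hm, hl', hlX, hmX, hlm⟩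
  · left
    have hlen := h.closed rfl
    have hnd := h.nodup
    have hleft := h.left
    rcases l with _ | ⟨x, _ | ⟨y, l⟩⟩
    · simp at hlen
    · simp at hlen
    -- A cycle is read as two paths between adjacent vertices `w` and `x`: the edge `wx` and the
    -- rest, traversed backwards.
    refine consistsOfDisjointPaths_of_seg (a := w) (b := x) ?_ ![[], l.reverse ++ [y]] ?_ ?_
      (fun z => ?_) (fun e he => ?_) (by simp)
    · grind
    · have h1 : G.Seg w [] x := h.append_left (l := [])
      have h2 : G.Seg x (y :: l) w := h.append_right (l := [])
      simpa [Fin.forall_fin_succ, h1] using h2.reverse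
    · simp [Fin.forall_fin_succ]
    · have := hV z
      simp [Fin.exists_fin_succ] at this ⊢
      tauto
    · have h1 := hE e he
      have h2 := mem_pathEdges_reverse (u := x) (l := y :: l) (v := w) (e := e)
      rw [List.reverse_cons] at h2
      simpa [Fin.exists_fin_succ, h2, pathEdges] using h1
  · obtain ⟨k, hk, hkV, hkE⟩ := h.rotate ha
    have hoff' : ∀ x ∈ l', x ∉ k := fun x hx hx' => hoff x hx ((hkV x).1 (Or.inr hx'))
    by_cases hab : a = b
    · subst hab
      exact absurd hG (not_adaptablyChoosable_of_two_cycles hl' hk hoff')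
    · right
      have hbk : b ∈ k := ((hkV b).2 hb).resolve_left (Ne.symm hab)
      obtain ⟨k₁, k₂, rfl⟩ := List.append_of_mem hbk
      have hnd := hk.nodup
      have hlen := hk.closed rfl
      refine hconn.consistsOfDisjointPaths_of_theta hdeg hG (a := a) (b := b) (l₁ := k₁)
        (l₂ := k₂.reverse) (l₃ := l') ⟨hab, hk.append_left, hk.append_right.reverse, hl', ?_, ?_,
          ?_, ?_, ?_, ?_⟩
      · grind
      · grind
      · grind
      · rintro rfl e
        simp at e
        simp [e] at hlen
      · rintro rfl e
        refine hnew e ((hkE _).1 ?_)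
        simp [pathEdges]
      · intro e e'
        rw [List.reverse_eq_nil_iff] at e
        subst e
        refine hnew e' ((hkE _).1 ?_)
        rw [mem_pathEdges_append]
        simp [pathEdges]
  · obtain ⟨k, hk, hkV, hkE⟩ := h.rotate ha
    refine absurd hG (not_adaptablyChoosable_of_dumbbell ?_ hk hl' hm ?_ ?_ hlm ?_ ?_)
    · rintro rfl
      exact hz ha
    · exact fun x hx hx' => hlX x hx' ((hkV x).1 (Or.inr hx))
    · exact fun x hx hx' => hmX x hx' ((hkV x).1 (Or.inr hx))
    · exact fun hx' => hlX a hx' ha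
    · exact fun hx => hz ((hkV z).1 (Or.inr hx))

/-! ### Reduction to connected graphs of minimum degree at least two -/

theorem AdaptablyChoosable.induce {G : SimpleGraph V} {k : ℕ} (h : G.AdaptablyChoosable k)
    (S : Set V) : (G.induce S).AdaptablyChoosable k := by
  classical
  rw [adaptablyChoosable_iff] at h ⊢
  intro L hL f
  obtain ⟨c, hc, hcf⟩ := h
    -- Off `S` any list of `k` colors will do, and edges not coming from `S` get the irrelevant
    -- color 0.
    (fun v => if hv : v ∈ S then L ⟨v, hv⟩ else (Finset.range k).map Nat.castEmbedding)
    (fun v => by split_ifs; exacts [hL _, by simp])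
    (fun e => if he : ∃ e' : Sym2 S, e'.map Subtype.val = e then f he.choose else 0)
  refine ⟨fun v => c v, fun v => by simpa using hc v, fun x y hxy => ?_⟩
  have he : ∃ e' : Sym2 S, e'.map Subtype.val = s((x : V), (y : V)) := ⟨s(x, y), rfl⟩
  have he' : he.choose = s(x, y) := Sym2.map.injective Subtype.val_injective he.choose_spec
  have := hcf x y hxy
  rwa [dif_pos he, he'] at this

/-- Strong induction on the vertex set to be colored: a disconnected set is split, a vertex with at
most one neighbor is removed and colored last, and the remaining case is the structure theorem for
the induced subgraph. -/
theorem AdaptablyChoosable.singleConflictColorable [Finite V] {G : SimpleGraph V}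
    (h : G.AdaptablyChoosable 2) : G.SingleConflictColorable 2 := by
  classical
  have := Fintype.ofFinite V
  rw [singleConflictColorable_iff]
  intro c
  suffices key : ∀ S : Finset V, ∃ φ : V → Fin 2,
      ∀ x ∈ S, ∀ y ∈ S, G.Adj x y → ¬ (φ x = c x y ∧ φ y = c y x) by
    obtain ⟨φ, hφ⟩ := key Finset.univ
    exact ⟨φ, fun x y => hφ x (Finset.mem_univ x) y (Finset.mem_univ y)⟩
  intro S
  induction S using Finset.strongInduction with
  | H S ih =>
  rcases S.eq_empty_or_nonempty with rfl | ⟨r, hr⟩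
  · exact ⟨fun _ => 0, by simp⟩
  let H : SimpleGraph S := G.induce (S : Set V)
  by_cases hconn : ∀ v : S, H.Reachable ⟨r, hr⟩ v
  · by_cases hdeg : ∀ v a : S, ∃ b, b ≠ a ∧ H.Adj v b
    · have hH : H.Connected := by
        have : Nonempty S := ⟨⟨r, hr⟩⟩
        exact ⟨fun x y => (hconn x).symm.trans (hconn y)⟩
      have hcol : H.SingleConflictColorable 2 := by
        rcases hH.consistsOfDisjointPaths hdeg (h.induce _) with h2 | h3
        · exact h2.singleConflictColorable (by omega)
        · exact h3.singleConflictColorable le_rfl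
      rw [singleConflictColorable_iff] at hcol
      obtain ⟨φ, hφ⟩ := hcol fun x y => c x y
      refine ⟨fun v => if hv : v ∈ S then φ ⟨v, hv⟩ else 0, fun x hx y hy hxy => ?_⟩
      simpa only [dif_pos hx, dif_pos hy] using hφ ⟨x, hx⟩ ⟨y, hy⟩ hxy
    · push Not at hdeg
      obtain ⟨⟨v, hv⟩, ⟨a, ha⟩, hva⟩ := hdeg
      obtain ⟨φ, hφ⟩ := ih (S.erase v) (Finset.erase_ssubset hv)
      have hva' : ∀ y ∈ S, G.Adj v y → y = a := fun y hy hvy => by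
        by_contra hne
        exact hva ⟨y, hy⟩ (fun e => hne (congrArg Subtype.val e)) hvy
      -- All neighbors of `v` in `S` equal `a`, so the color of `v` other than `c v a` avoids every
      -- conflict at `v`.
      refine ⟨Function.update φ v (1 - c v a), fun x hx y hy hxy => ?_⟩
      by_cases hxv : x = v
      · subst hxv
        obtain rfl := hva' y hy hxy
        rw [Function.update_self]
        omega
      by_cases hyv : y = v
      · subst hyv
        obtain rfl := hva' x hx hxy.symm
        rw [Function.update_self]
        omega
      rw [Function.update_of_ne hxv, Function.update_of_ne hyv]
      exact hφ x (Finset.mem_erase.2 ⟨hxv, hx⟩) y (Finset.mem_erase.2 ⟨hyv, hy⟩) hxy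
  · push Not at hconn
    obtain ⟨z, hz⟩ := hconn
    let P : V → Prop := fun v => ∃ hv : v ∈ S, H.Reachable ⟨r, hr⟩ ⟨v, hv⟩
    have hP : ∀ x ∈ S, ∀ y ∈ S, G.Adj x y → P x → P y := fun x hx y hy hxy ⟨_, hp⟩ =>
      ⟨hy, hp.trans (Adj.reachable (G := H) (u := ⟨x, hx⟩) (v := ⟨y, hy⟩) hxy)⟩
    obtain ⟨φ, hφ⟩ := ih (S.filter P) (Finset.filter_ssubset.2 ⟨z, z.2, fun ⟨_, hp⟩ => hz hp⟩)
    obtain ⟨ψ, hψ⟩ := ih (S.filter fun v => ¬ P v)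
      (Finset.filter_ssubset.2 ⟨r, hr, not_not.2 ⟨hr, Reachable.refl _⟩⟩)
    refine ⟨fun v => if P v then φ v else ψ v, fun x hx y hy hxy => ?_⟩
    by_cases hx' : P x
    · have hy' := hP x hx y hy hxy hx'
      simpa only [if_pos hx', if_pos hy'] using hφ x (Finset.mem_filter.2 ⟨hx, hx'⟩) y
        (Finset.mem_filter.2 ⟨hy, hy'⟩) hxy
    · have hy' : ¬ P y := fun h => hx' (hP y hy x hx hxy.symm h)
      simpa only [if_neg hx', if_neg hy'] using hψ x (Finset.mem_filter.2 ⟨hx, hx'⟩) y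
        (Finset.mem_filter.2 ⟨hy, hy'⟩) hxy

theorem exists_adj_ne_of_two_le_minDegree [Fintype V] {G : SimpleGraph V} [DecidableRel G.Adj]
    (h : 2 ≤ G.minDegree) (v a : V) : ∃ b, b ≠ a ∧ G.Adj v b := by
  have hv : 1 < (G.neighborFinset v).card := h.trans (G.minDegree_le_degree v)
  obtain ⟨b, hb, hba⟩ := Finset.exists_mem_ne hv a
  exact ⟨b, hba, (G.mem_neighborFinset v b).1 hb⟩

end SimpleGraph

theorem mainTheorem5 {V : Type*} [Fintype V] (G : SimpleGraph V) [DecidableRel G.Adj] :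
    (G.Connected → 2 ≤ G.minDegree →
      (G.SingleConflictColorable 2 ↔
        G.ConsistsOfDisjointPaths 2 ∨ G.ConsistsOfDisjointPaths 3)) ∧
    (G.SingleConflictColorable 2 ↔ G.AdaptablyChoosable 2) := by
  refine ⟨fun hconn hdeg => ⟨fun h => ?_, ?_⟩, fun h => h.adaptablyChoosable,
    fun h => h.singleConflictColorable⟩
  · exact hconn.consistsOfDisjointPaths
      (SimpleGraph.exists_adj_ne_of_two_le_minDegree hdeg) h.adaptablyChoosable
  · rintro (h | h)
    · exact h.singleConflictColorable (by omega)
    · exact h.singleConflictColorable le_rfl
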